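/- Theorem 1.8. For a field $K$ and a finite group $G$, let $G$ act on the rational function field $K(x(g):g\in G)$ by $K$-automorphisms with $h\cdot x(g)=x(hg)$, and let $K(G)=K(x(g):g\in G)^G$ be the fixed field. Let $K$ be a field with $\operatorname{char}K=p>0$, and let $1\to H\to\widetilde G\to G\to 1$ be a group extension, where $H$ and $G$ are finite groups. If $H$ is a cyclic $p$-group, or an abelian $p$-group lying in the center of $\widetilde G$, then $K(\widetilde G)$ is rational over $K(G)$; that is, there is a $K$-embedding of fields $K(G)\to K(\widetilde G)$ such that $K(\widetilde G)$ is purely transcendental (generated by finitely many algebraically independent elements) over the image of $K(G)$. -/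

import Mathlib

noncomputable section

namespace Noether

/-- The rational function field `K(x(g) : g ∈ G)`, with one variable for each element of `G`. -/
abbrev RatFunField (K G : Type*) [Field K] : Type _ :=
  FractionRing (MvPolynomial G K)

/-- The variable `x(g)` of `K(x(g) : g ∈ G)`. -/
def var (K : Type*) {G : Type*} [Field K] (g : G) : RatFunField K G :=
  algebraMap (MvPolynomial G K) (RatFunField K G) (MvPolynomial.X g)

/-- The action of `G` on the polynomial ring `K[x(g) : g ∈ G]` by `K`-algebra automorphisms
with `h · x(g) = x(hg)`. -/
def polyAction (K G : Type*) [Field K] [Group G] :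
    G →* (MvPolynomial G K ≃ₐ[K] MvPolynomial G K) where
  toFun h := MvPolynomial.renameEquiv K (Equiv.mulLeft h)
  map_one' := by
    ext p
    simp
  map_mul' a b := by
    apply AlgEquiv.coe_toAlgHom_injective
    apply MvPolynomial.algHom_ext
    intro g
    simp [mul_assoc]

/-- The induced action of `G` on the field `K(x(g) : g ∈ G)` by `K`-automorphisms. -/
def regularAction (K G : Type*) [Field K] [Group G] :
    G →* (RatFunField K G ≃ₐ[K] RatFunField K G) :=
  (IsFractionRing.fieldEquivOfAlgEquivHom K (RatFunField K G)).comp (polyAction K G)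

theorem regularAction_var (K : Type*) {G : Type*} [Field K] [Group G] (h g : G) :
    regularAction K G h (var K g) = var K (h * g) := by
  simp [regularAction, var, polyAction]

/-- The fixed field `K(G) = K(x(g) : g ∈ G)^G`, an intermediate field of
`K(x(g) : g ∈ G)` over `K`. -/
def noetherField (K G : Type*) [Field K] [Group G] : IntermediateField K (RatFunField K G) :=
  IntermediateField.fixedField (regularAction K G).range

theorem mem_noetherField (K : Type*) {G : Type*} [Field K] [Group G] (f : RatFunField K G) :
    f ∈ noetherField K G ↔ ∀ h : G, regularAction K G h f = f := by
  simp [noetherField, IntermediateField.mem_fixedField_iff]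

/-- `E` is rational (purely transcendental) over `F`: it is generated, as a field extension of `F`,
by finitely many elements that are algebraically independent over `F`. -/
def IsRational (F E : Type*) [Field F] [Field E] [Algebra F E] : Prop :=
  ∃ (n : ℕ) (z : Fin n → E),
    AlgebraicIndependent F z ∧ IntermediateField.adjoin F (Set.range z) = ⊤

end Noether

end

noncomputable section

namespace Noether

open MvPolynomial

/-! Transcendence degree turns rationality into a count. The fixed fields of Γ and G have degrees
|Γ| and |G| over K, so any |Γ| - |G| generators over an embedded copy of K(G) are automatically
independent (`isRational_of_adjoin_eq_top`). Generation with this bound composes along towers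
(`IsSparselyGenerated.trans`). A nontrivial cyclic or central p-kernel contains a subgroup of order
p normal in Γ, and the quotient kernel is again cyclic or central, so induction leaves only kernels
N of order p.

Let M be the rational function field of Γ, and L the copy of that of G obtained by sending x(g) to
the sum of the variables over g. As char K = p, some linear form divided by the sum of all variables
gives y which N translates by the elements of F_p, and on which Γ acts by y ↦ ay + e with a in F_p^×
and e in L. So y^p - y is fixed by N and transforms affinely under Γ; summing conjugates makes some
z' = α(y^p - y) + β invariant, with α ≠ 0 and β in L.

The group acts faithfully on L(y), and M is generated over L(y) by |Γ| - |G| - 1 variables which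
together with 1 span a stable space. Galois descent replaces them by as many invariants w. Let E be
generated by the invariants of L, z' and w. The products l y^j with l in L and j < p span M over E,
and their conjugate sums lie in L because power sums over F_p are constants. Hence conjugate sums
map M into E, which forces E to be the whole fixed field (`exists_generators_fixedField`). -/

theorem var_injective (K Γ : Type*) [Field K] : Function.Injective (var K : Γ → RatFunField K Γ) :=
  (IsFractionRing.injective (MvPolynomial Γ K) (RatFunField K Γ)).comp (X_injective (R := K))

theorem regularAction_injective (K Γ : Type*) [Field K] [Group Γ] :
    Function.Injective (regularAction K Γ) := by
  intro a b h
  have := DFunLike.congr_fun h (var K (1 : Γ))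
  rw [regularAction_var, regularAction_var, mul_one, mul_one] at this
  exact var_injective K Γ this

theorem regularAction_mul_apply (K : Type*) {Γ : Type*} [Field K] [Group Γ] (a b : Γ)
    (f : RatFunField K Γ) :
    regularAction K Γ (a * b) f = regularAction K Γ a (regularAction K Γ b f) := by
  rw [map_mul]; rfl

/-- A field containing all the variables is everything. -/
theorem eq_top_of_var_mem {K Γ : Type*} [Field K] (E : IntermediateField K (RatFunField K Γ))
    (h : ∀ γ, var K γ ∈ E) : E = ⊤ := by
  have hp : ∀ q : MvPolynomial Γ K, algebraMap _ (RatFunField K Γ) q ∈ E := by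
    intro q
    induction q using MvPolynomial.induction_on with
    | C a =>
      have : algebraMap (MvPolynomial Γ K) (RatFunField K Γ) (C a) = algebraMap K _ a := by
        rw [IsScalarTower.algebraMap_apply K (MvPolynomial Γ K) (RatFunField K Γ)]; rfl
      rw [this]; exact E.algebraMap_mem a
    | add p q hp hq => rw [map_add]; exact E.add_mem hp hq
    | mul_X p g hp => rw [map_mul]; exact E.mul_mem hp (h g)
  rw [eq_top_iff]
  intro f _
  obtain ⟨a, b, hb, rfl⟩ := IsFractionRing.div_surjective (A := MvPolynomial Γ K) f
  exact E.div_mem (hp a) (hp b)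

/-- Two algebra homomorphisms that agree on the variables are equal. -/
theorem algHom_ext_var {K Γ : Type*} [Field K] {F : Type*} [Field F] [Algebra K F]
    {f g : RatFunField K Γ →ₐ[K] F} (h : ∀ γ, f (var K γ) = g (var K γ)) : f = g := by
  let E : IntermediateField K (RatFunField K Γ) :=
    { AlgHom.equalizer f g with
      inv_mem' := fun x (hx : f x = g x) => show f x⁻¹ = g x⁻¹ by rw [map_inv₀, map_inv₀, hx] }
  have : E = ⊤ := eq_top_of_var_mem E h
  refine AlgHom.ext fun x => ?_
  have hx : x ∈ E := this ▸ IntermediateField.mem_top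
  exact hx

/-! ### Linear forms in the variables -/

section Linear

variable (K : Type*) {Γ : Type*} [Field K] [Fintype Γ]

/-- The linear form with given coefficients. -/
def linForm : (Γ → K) →ₗ[K] RatFunField K Γ := Fintype.linearCombination K (var K)

theorem linForm_apply (c : Γ → K) : linForm K c = ∑ γ, c γ • var K γ := rfl

theorem linForm_injective : Function.Injective (linForm K : (Γ → K) →ₗ[K] RatFunField K Γ) := by
  have : LinearIndependent K (var K : Γ → RatFunField K Γ) := by
    have h := (MvPolynomial.linearIndependent_X Γ K).map'
      (IsScalarTower.toAlgHom K (MvPolynomial Γ K) (RatFunField K Γ)).toLinearMap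
      (LinearMap.ker_eq_bot.mpr (IsFractionRing.injective (MvPolynomial Γ K) (RatFunField K Γ)))
    exact h
  exact linearIndependent_iff_injective_fintypeLinearCombination.mp this

theorem linForm_ne_zero {c : Γ → K} (h : c ≠ 0) : linForm K c ≠ 0 := by
  intro h2
  exact h (linForm_injective K (by rw [h2, map_zero]))

theorem regularAction_linForm [Group Γ] (τ : Γ) (c : Γ → K) :
    regularAction K Γ τ (linForm K c) = linForm K (fun γ => c (τ⁻¹ * γ)) := by
  simp only [linForm_apply, map_sum, map_smul, regularAction_var]
  refine Fintype.sum_equiv (Equiv.mulLeft τ) _ _ (fun γ => ?_)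
  simp

end Linear

/-! ### Embedding the function field of a quotient group -/

section Inflation

variable (K : Type*) {Γ G : Type*} [Field K] [Fintype Γ] [Group Γ] [Group G]
  (π : Γ →* G)

open Classical in
/-- The polynomial map sending a variable to the sum of the variables in its fibre. -/
def polyInflation : MvPolynomial G K →ₐ[K] MvPolynomial Γ K :=
  aeval (fun g => ∑ γ, if π γ = g then X γ else 0)

theorem polyInflation_injective (hπ : Function.Surjective π) : Function.Injective (polyInflation K π) := by
  classical
  obtain ⟨s, hs⟩ := hπ.hasRightInverse
  -- A retraction: keep the variable that `s` selects in each fibre and kill the others.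
  let r : MvPolynomial Γ K →ₐ[K] MvPolynomial G K :=
    aeval (fun γ => if s (π γ) = γ then X (π γ) else 0)
  have : r.comp (polyInflation K π) = AlgHom.id K _ := by
    apply MvPolynomial.algHom_ext
    intro g
    simp only [polyInflation, AlgHom.comp_apply, aeval_X, map_sum, AlgHom.id_apply]
    rw [Finset.sum_eq_single (s g)]
    · simp [r, hs g]
    · intro γ _ hγ
      split_ifs with h
      · have h3 : s (π γ) ≠ γ := fun h3 => hγ (by rw [← h3, h])
        simp [r, h3]
      · simp
    · simp
  intro a b hab
  have h2 := congrArg r hab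
  have e : ∀ q, r (polyInflation K π q) = q := fun q => DFunLike.congr_fun this q
  rwa [e, e] at h2

variable (hπ : Function.Surjective π)

theorem toAlgHom_comp_polyInflation_injective (hπ : Function.Surjective π) :
    Function.Injective ((IsScalarTower.toAlgHom K (MvPolynomial Γ K)
      (RatFunField K Γ)).comp (polyInflation K π)) :=
  (IsFractionRing.injective (MvPolynomial Γ K) (RatFunField K Γ)).comp
    (polyInflation_injective K π hπ)

/-- The embedding of `K(x(g) : g ∈ G)` into `K(x(γ) : γ ∈ Γ)` for `Γ → G` surjective. -/
def inflation : RatFunField K G →ₐ[K] RatFunField K Γ :=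
  IsFractionRing.liftAlgHom (toAlgHom_comp_polyInflation_injective K π hπ)

open Classical in
theorem inflation_var (g : G) :
    inflation K π hπ (var K g) = ∑ γ, if π γ = g then var K γ else 0 := by
  have : inflation K π hπ (var K g) =
      algebraMap (MvPolynomial Γ K) (RatFunField K Γ) (polyInflation K π (X g)) := by
    rw [inflation, var, IsFractionRing.liftAlgHom_apply, IsFractionRing.lift_algebraMap]
    rfl
  rw [this]
  simp only [polyInflation, aeval_X, map_sum]
  refine Finset.sum_congr rfl (fun γ _ => ?_)
  split_ifs
  · rfl
  · simp

theorem inflation_linForm [Fintype G] (d : G → K) :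
    inflation K π hπ (linForm K d) = linForm K (fun γ => d (π γ)) := by
  classical
  simp only [linForm_apply, map_sum, map_smul, inflation_var, Finset.smul_sum, smul_ite, smul_zero]
  rw [Finset.sum_comm]
  refine Finset.sum_congr rfl (fun γ _ => ?_)
  simp

theorem inflation_regularAction (τ : Γ) (f : RatFunField K G) :
    regularAction K Γ τ (inflation K π hπ f) =
      inflation K π hπ (regularAction K G (π τ) f) := by
  classical
  have : ((regularAction K Γ τ : RatFunField K Γ →ₐ[K] RatFunField K Γ).comp
      (inflation K π hπ)) =
      (inflation K π hπ).comp (regularAction K G (π τ) : RatFunField K G →ₐ[K] RatFunField K G) := by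
    apply algHom_ext_var
    intro g
    change regularAction K Γ τ (inflation K π hπ (var K g)) =
      inflation K π hπ (regularAction K G (π τ) (var K g))
    rw [regularAction_var, inflation_var, inflation_var, map_sum]
    refine Fintype.sum_equiv (Equiv.mulLeft τ) _ _ (fun γ => ?_)
    rw [apply_ite (regularAction K Γ τ), regularAction_var, map_zero]
    simp
  exact DFunLike.congr_fun this f

theorem inflation_mem_noetherField_iff (f : RatFunField K G) :
    inflation K π hπ f ∈ noetherField K Γ ↔ f ∈ noetherField K G := by
  simp only [mem_noetherField, inflation_regularAction]
  constructor
  · intro h g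
    obtain ⟨γ, rfl⟩ := hπ g
    exact (inflation K π hπ).injective (h γ)
  · intro h γ
    rw [h]

/-- The restriction of the inflation map to fixed fields. -/
def noetherInflation : noetherField K G →ₐ[K] noetherField K Γ :=
  ((inflation K π hπ).comp (noetherField K G).val).codRestrict (noetherField K Γ).toSubalgebra
    (fun f => (inflation_mem_noetherField_iff K π hπ f).mpr f.2)

end Inflation

/-! ### Conjugate sums, independence of characters and descent -/

section Trace

variable {K Γ M : Type*} [Field K] [Group Γ] [Field M] [Algebra K M] (ρ : Γ →* (M ≃ₐ[K] M))

theorem isIntegral_fixedField [Finite Γ] (f : M) :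
    IsIntegral (IntermediateField.fixedField ρ.range) f := by
  have : Finite ρ.range := Set.finite_range ρ
  exact FixedPoints.isIntegral ρ.range M f

theorem mem_fixedField_range {f : M} :
    f ∈ IntermediateField.fixedField ρ.range ↔ ∀ τ, ρ τ f = f := by
  simp [IntermediateField.mem_fixedField_iff]

variable [Fintype Γ]

/-- The sum of the conjugates. -/
def conjSum (f : M) : M := ∑ τ, ρ τ f

theorem conjSum_mem (f : M) : conjSum ρ f ∈ IntermediateField.fixedField ρ.range := by
  rw [mem_fixedField_range]
  intro h
  rw [conjSum, map_sum]
  refine Fintype.sum_equiv (Equiv.mulLeft h) _ _ (fun γ => ?_)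
  rw [Equiv.coe_mulLeft, map_mul]; rfl

/-- Dedekind's independence of characters on a subfield. -/
theorem eq_zero_of_sum_mul_eq_zero (L : IntermediateField K M)
    (hL : ∀ τ, (∀ l ∈ L, ρ τ l = l) → τ = 1)
    (a : Γ → M) (h : ∀ l ∈ L, ∑ τ, a τ * ρ τ l = 0) (τ : Γ) : a τ = 0 := by
  let f : Γ → (L →* M) := fun τ => ((ρ τ : M ≃ₐ[K] M) : M →* M).comp (L.val : L →* M)
  have hf : Function.Injective f := by
    intro σ τ hστ
    have : τ⁻¹ * σ = 1 := by
      apply hL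
      intro l hl
      have h1 : ρ σ l = ρ τ l := DFunLike.congr_fun hστ ⟨l, hl⟩
      rw [map_mul, AlgEquiv.mul_apply, h1, ← AlgEquiv.mul_apply, ← map_mul, inv_mul_cancel,
        map_one, AlgEquiv.one_apply]
    exact (inv_mul_eq_one.mp this).symm
  have hli := (linearIndependent_monoidHom L M).comp f hf
  rw [Fintype.linearIndependent_iff] at hli
  apply hli a
  ext l
  have := h l l.2
  simpa [f, Finset.sum_apply] using this

/-- Conjugate sums are E-linear, so the hypothesis on `B` puts all of them in E. An invariant m is
then the quotient of the sums of m * c and of c, where c is any element with nonzero sum; no field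
degree has to be computed. -/
theorem fixedField_le_of_span (hρ : Function.Injective ρ) {E : IntermediateField K M}
    (hE : E ≤ IntermediateField.fixedField ρ.range) (B : Set M)
    (hB : ∀ b ∈ B, conjSum ρ b ∈ E) (hspan : Submodule.span E B = ⊤) :
    IntermediateField.fixedField ρ.range ≤ E := by
  have hall : ∀ m : M, conjSum ρ m ∈ E := by
    intro m
    have hm : m ∈ Submodule.span E B := hspan ▸ Submodule.mem_top
    induction hm using Submodule.span_induction with
    | mem x h => exact hB x h
    | zero => simp [conjSum]
    | add x y _ _ hx hy =>
      have : conjSum ρ (x + y) = conjSum ρ x + conjSum ρ y := by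
        simp [conjSum, Finset.sum_add_distrib]
      rw [this]; exact E.add_mem hx hy
    | smul a x _ hx =>
      have : conjSum ρ (a • x) = a * conjSum ρ x := by
        simp only [conjSum, Finset.mul_sum, Algebra.smul_def, map_mul]
        refine Finset.sum_congr rfl (fun τ _ => ?_)
        congr 1
        exact (mem_fixedField_range ρ).mp (hE a.2) τ
      rw [this]; exact E.mul_mem a.2 hx
  obtain ⟨c, hc⟩ : ∃ c : M, conjSum ρ c ≠ 0 := by
    by_contra! hcon
    have := eq_zero_of_sum_mul_eq_zero ρ ⊤
      (fun τ h => hρ (by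
        ext f; rw [h f IntermediateField.mem_top, map_one]; rfl))
      (fun _ => 1) (fun l _ => by simpa [conjSum] using hcon l) 1
    exact one_ne_zero this
  intro m hm
  have h1 : conjSum ρ (m * c) = m * conjSum ρ c := by
    simp only [conjSum, Finset.mul_sum, map_mul, (mem_fixedField_range ρ).mp hm]
  have : m = conjSum ρ (m * c) / conjSum ρ c := by rw [h1]; field_simp
  rw [this]
  exact E.div_mem (hall _) (hall _)

/-- Galois descent: a stable subspace is spanned by its invariant vectors. -/
theorem le_span_fixedField (L : IntermediateField K M)
    (hL : ∀ τ, (∀ l ∈ L, ρ τ l = l) → τ = 1) (hstab : ∀ τ, ∀ l ∈ L, ρ τ l ∈ L)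
    (U : Submodule L M) (hU : ∀ τ, ∀ u ∈ U, ρ τ u ∈ U) :
    U ≤ Submodule.span L {u | u ∈ U ∧ u ∈ IntermediateField.fixedField ρ.range} := by
  intro u hu
  by_contra hcon
  obtain ⟨f, hfu, hf⟩ := Submodule.exists_le_ker_of_notMem hcon
  -- The functional `f` kills the conjugate sum of `l * u`, so ∑ τ(l) f(τ u) = 0 for every l in L.
  -- Independence of characters makes each f(τ u) vanish, and τ = 1 contradicts f(u) ≠ 0.
  have key := eq_zero_of_sum_mul_eq_zero ρ L hL
    (fun τ => (f (ρ τ u) : M)) (fun l hl => by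
      have h1 : conjSum ρ (l * u) ∈
          Submodule.span L {u | u ∈ U ∧ u ∈ IntermediateField.fixedField ρ.range} := by
        apply Submodule.subset_span
        refine ⟨Submodule.sum_mem _ (fun τ _ => hU τ _ ?_), conjSum_mem ρ _⟩
        exact U.smul_mem ⟨l, hl⟩ hu
      have h2 : f (conjSum ρ (l * u)) = 0 := hf h1
      have h3 : conjSum ρ (l * u) = ∑ τ, (⟨ρ τ l, hstab τ l hl⟩ : L) • ρ τ u := by
        simp only [conjSum, map_mul]; rfl
      rw [h3, map_sum] at h2
      have h4 := congrArg (fun x : L => (x : M)) h2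
      simp only [map_smul, smul_eq_mul] at h4
      rw [← h4.trans (by rfl : ((0 : L) : M) = 0)]
      push_cast
      exact Finset.sum_congr rfl (fun τ _ => mul_comm _ _)) 1
  rw [map_one] at key
  exact hfu (Subtype.ext key)

end Trace

/-! ### Transcendence degrees and counting generators -/

section Trdeg

variable (K G : Type*) [Field K]

theorem trdeg_ratFunField :
    Algebra.trdeg K (RatFunField K G) = Algebra.trdeg K (MvPolynomial G K) := by
  have : Algebra.IsAlgebraic (MvPolynomial G K) (RatFunField K G) :=
    IsLocalization.isAlgebraic _ (nonZeroDivisors (MvPolynomial G K))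
  have h := trdeg_add_eq K (MvPolynomial G K) (A := RatFunField K G)
  rw [trdeg_eq_zero (R := MvPolynomial G K), add_zero] at h
  exact h.symm

theorem trdeg_noetherField [Group G] [Finite G] :
    Algebra.trdeg K (noetherField K G) = Nat.card G := by
  have : Algebra.IsAlgebraic (noetherField K G) (RatFunField K G) :=
    ⟨fun f => (isIntegral_fixedField (regularAction K G) f).isAlgebraic⟩
  have h := trdeg_add_eq K (noetherField K G) (A := RatFunField K G)
  rw [trdeg_eq_zero (R := noetherField K G), add_zero, trdeg_ratFunField,
    MvPolynomial.trdeg_of_isDomain] at h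
  have := Fintype.ofFinite G
  rw [h]; simp

end Trdeg

theorem le_trdeg_fieldRange {K A B : Type*} [Field K] [Field A] [Field B] [Algebra K A]
    [Algebra K B] (φ : A →ₐ[K] B) {m n s : ℕ} (hA : Algebra.trdeg K A = m)
    (hB : Algebra.trdeg K B = n) (h : m + s ≤ n) : (s : Cardinal) ≤ Algebra.trdeg φ.fieldRange B := by
  have h1 := trdeg_add_eq K φ.fieldRange (A := B)
  have h2 := AlgEquiv.lift_trdeg_eq (AlgEquiv.ofInjectiveField φ)
  rw [hA, Cardinal.lift_natCast] at h2
  have h3 : Algebra.trdeg K φ.fieldRange = (m : Cardinal) := by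
    have : Algebra.trdeg K φ.range = (m : Cardinal) :=
      Cardinal.lift_injective (by rw [← h2, Cardinal.lift_natCast])
    exact this
  rw [h3, hB] at h1
  have h4 : (s : Cardinal) + m ≤ Algebra.trdeg φ.fieldRange B + m := by
    rw [add_comm _ (m : Cardinal), add_comm _ (m : Cardinal), h1]; exact_mod_cast h
  exact (Cardinal.add_le_add_iff_of_lt_aleph0 (Cardinal.natCast_lt_aleph0)).mp h4

open IntermediateField.algebraAdjoinAdjoin in
/-- Generators are algebraically independent as soon as there are no more of them than the
transcendence degree. -/
theorem isRational_of_adjoin_eq_top {F E : Type*} [Field F] [Field E] [Algebra F E]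
    (S : Finset E) (hS : IntermediateField.adjoin F (S : Set E) = ⊤)
    (hle : (S.card : Cardinal) ≤ Algebra.trdeg F E) : IsRational F E := by
  let z : Fin S.card → E := fun i => S.equivFin.symm i
  have hz : Set.range z = (S : Set E) := by
    ext x
    constructor
    · rintro ⟨i, rfl⟩; exact (S.equivFin.symm i).2
    · intro hx; exact ⟨S.equivFin ⟨x, hx⟩, by simp [z]⟩
  have hz' : IntermediateField.adjoin F (Set.range z) = ⊤ := by rw [hz, hS]
  refine ⟨S.card, z, ?_, hz'⟩
  have h1 : Algebra.IsAlgebraic (IntermediateField.adjoin F (Set.range z)) E := by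
    rw [hz']
    exact ⟨fun x => isAlgebraic_algebraMap
      (⟨x, IntermediateField.mem_top⟩ : (⊤ : IntermediateField F E))⟩
  have : Algebra.IsAlgebraic (Algebra.adjoin F (Set.range z)) E :=
    (IsFractionRing.comap_isAlgebraic_iff (A := Algebra.adjoin F (Set.range z))
      (K := IntermediateField.adjoin F (Set.range z)) (C := E)).mpr h1
  exact (Algebra.IsAlgebraic.isTranscendenceBasis_of_lift_le_trdeg_of_finite F z (by simpa using hle)).1

/-- `K(Γ)` is generated over an embedded copy of `K(G)` by at most `|Γ| - |G|` elements. -/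
def IsSparselyGenerated (K Γ G : Type*) [Field K] [Group Γ] [Group G] : Prop :=
  ∃ (φ : noetherField K G →ₐ[K] noetherField K Γ) (S : Finset (noetherField K Γ)),
    IntermediateField.adjoin K (Set.range φ ∪ S) = ⊤ ∧ Nat.card G + S.card ≤ Nat.card Γ

section

variable {K Γ Δ G : Type*} [Field K] [Group Γ] [Group Δ] [Group G]

theorem IsSparselyGenerated.trans (h₁ : IsSparselyGenerated K Γ Δ)
    (h₂ : IsSparselyGenerated K Δ G) : IsSparselyGenerated K Γ G := by
  classical
  obtain ⟨ψ, T, hT, hcT⟩ := h₁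
  obtain ⟨φ, S, hS, hcS⟩ := h₂
  refine ⟨ψ.comp φ, S.image ψ ∪ T, ?_, ?_⟩
  · rw [eq_top_iff, ← hT, IntermediateField.adjoin_le_iff]
    have hψ : Set.range ψ ⊆ (IntermediateField.adjoin K
        (Set.range (ψ.comp φ) ∪ ↑(S.image ψ ∪ T)) : Set (noetherField K Γ)) := by
      have : (⊤ : IntermediateField K (noetherField K Δ)).map ψ ≤ IntermediateField.adjoin K
        (Set.range (ψ.comp φ) ∪ ↑(S.image ψ ∪ T)) := by
        rw [← hS, IntermediateField.adjoin_map]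
        apply IntermediateField.adjoin.mono
        rw [Set.image_union, AlgHom.coe_comp, Set.range_comp, Finset.coe_union, Finset.coe_image,
          ← Set.union_assoc]
        exact Set.subset_union_left
      rintro _ ⟨x, rfl⟩
      exact this ⟨x, IntermediateField.mem_top, rfl⟩
    refine Set.union_subset hψ fun x hx => ?_
    apply IntermediateField.subset_adjoin
    right
    simp only [Finset.coe_union]
    exact Or.inr hx
  · have h1 := Finset.card_union_le (S.image ψ) T
    have h2 := Finset.card_image_le (s := S) (f := ψ)
    omega

theorem IsSparselyGenerated.isRational [Finite Γ] [Finite G] (h : IsSparselyGenerated K Γ G) :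
    ∃ φ : noetherField K G →ₐ[K] noetherField K Γ, IsRational φ.fieldRange (noetherField K Γ) := by
  obtain ⟨φ, S, hS, hc⟩ := h
  refine ⟨φ, isRational_of_adjoin_eq_top S ?_ ?_⟩
  · have h : (⊤ : IntermediateField K (noetherField K Γ)) ≤
        (IntermediateField.adjoin φ.fieldRange (S : Set (noetherField K Γ))).restrictScalars K := by
      rw [← hS, IntermediateField.adjoin_le_iff]
      refine Set.union_subset ?_ (IntermediateField.subset_adjoin _ _)
      rintro _ ⟨x, rfl⟩
      exact (IntermediateField.adjoin φ.fieldRange (S : Set (noetherField K Γ))).algebraMap_mem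
        ⟨φ x, ⟨x, rfl⟩⟩
    rw [eq_top_iff]
    intro x _
    exact h (IntermediateField.mem_top (x := x))
  · exact le_trdeg_fieldRange φ (trdeg_noetherField K G) (trdeg_noetherField K Γ) hc

theorem isSparselyGenerated_of_bijective [Finite Γ] (π : Γ →* G) (hπ : Function.Bijective π) :
    IsSparselyGenerated K Γ G := by
  classical
  have := Fintype.ofFinite Γ
  refine ⟨noetherInflation K π hπ.2, ∅, ?_, ?_⟩
  · have htop : (inflation K π hπ.2).fieldRange = ⊤ := by
      apply eq_top_of_var_mem
      intro γ
      refine ⟨var K (π γ), ?_⟩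
      change inflation K π hπ.2 (var K (π γ)) = _
      rw [inflation_var, Finset.sum_eq_single γ]
      · simp
      · intro δ _ hδ
        rw [if_neg (fun h => hδ (hπ.1 h))]
      · simp
    rw [eq_top_iff]
    intro f _
    apply IntermediateField.subset_adjoin
    left
    obtain ⟨g, hg⟩ : (f : RatFunField K Γ) ∈ (inflation K π hπ.2).fieldRange :=
      htop ▸ IntermediateField.mem_top
    have hg' : inflation K π hπ.2 g = f := hg
    refine ⟨⟨g, (inflation_mem_noetherField_iff K π hπ.2 g).mp (hg' ▸ f.2)⟩, ?_⟩
    exact Subtype.ext hg'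
  · rw [Nat.card_congr (Equiv.ofBijective π hπ)]; simp

end

/-! ### The Artin–Schreier element and generators of the fixed field -/

/-- The coefficients of a linear form that is an additive character along the kernel. -/
theorem exists_coeff (K : Type*) {Γ G : Type*} [Field K] [Group Γ] [Group G]
    {p : ℕ} [Fact p.Prime] [CharP K p] (π : Γ →* G) (hπ : Function.Surjective π)
    (hker : Nat.card π.ker = p) :
    ∃ (s : G → Γ) (c : Γ → K) (ℓ : π.ker ≃ ZMod p), (∀ g, π (s g) = g) ∧ (∀ g, c (s g) = 0) ∧
      (∀ (h : π.ker) (γ : Γ), c (h * γ) = c γ + ZMod.castHom (dvd_refl p) K (ℓ h)) ∧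
      (∀ τ, ∃ a : K, a ≠ 0 ∧ a ^ p = a ∧ ∃ d : G → K, ∀ γ, c (τ⁻¹ * γ) = a * c γ + d (π γ)) := by
  obtain ⟨s, hs⟩ := hπ.hasRightInverse
  have hs' : ∀ g, π (s g) = g := hs
  let e : π.ker ≃* Multiplicative (ZMod p) := mulEquivOfPrimeCardEq (p := p) hker (by simp)
  let ℓ : π.ker ≃ ZMod p := e.toEquiv.trans Multiplicative.toAdd
  have hℓ : ∀ x y, ℓ (x * y) = ℓ x + ℓ y := fun x y => by
    change Multiplicative.toAdd (e (x * y)) = _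
    rw [map_mul]; rfl
  let f := ZMod.castHom (dvd_refl p) K
  have hmem : ∀ γ, γ * (s (π γ))⁻¹ ∈ π.ker := fun γ => by
    rw [MonoidHom.mem_ker, map_mul, map_inv, hs', mul_inv_cancel]
  let r : Γ → π.ker := fun γ => ⟨γ * (s (π γ))⁻¹, hmem γ⟩
  have hr : ∀ γ, γ = r γ * s (π γ) := fun γ => by simp [r]
  have hrmul : ∀ (h : π.ker) γ, r (h * γ) = h * r γ := fun h γ => by
    apply Subtype.ext
    have : π h = 1 := h.2
    simp [r, this, mul_assoc]
  have hc : ∀ (h : π.ker) (γ : Γ), f (ℓ (r (h * γ))) = f (ℓ (r γ)) + f (ℓ h) := fun h γ => by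
    rw [hrmul, hℓ, map_add, add_comm]
  refine ⟨s, fun γ => f (ℓ (r γ)), ℓ, hs', fun g => ?_, hc, fun τ => ?_⟩
  · have h1 : r (s g) = 1 := Subtype.ext (by simp [r, hs'])
    have h2 : ℓ 1 = 0 := by simpa using hℓ 1 1
    simp only [h1, h2, map_zero]
  -- Conjugation is an automorphism of a group of order p, hence multiplication by the nonzero
  -- scalar `ψ 1` of F_p; this is the coefficient a.
  · let κ : π.ker ≃* π.ker := MulAut.conjNormal τ⁻¹
    let ψ : ZMod p →+ ZMod p :=
      { toFun := fun x => ℓ (κ (ℓ.symm x))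
        map_zero' := by
          have h2 : ℓ 1 = 0 := by simpa using hℓ 1 1
          rw [← h2, Equiv.symm_apply_apply, map_one]
        map_add' := fun x y => by
          have : ℓ.symm (x + y) = ℓ.symm x * ℓ.symm y := ℓ.injective (by rw [hℓ]; simp)
          rw [this, map_mul, hℓ] }
    have hψ : ∀ x, ψ x = ψ 1 * x := fun x => by
      have := map_smul (ψ.toZModLinearMap p) x 1
      simpa [mul_comm] using this
    have hψ1 : ψ 1 ≠ 0 := by
      intro h
      have h1 : ψ 1 = ψ 0 := by rw [h, map_zero]
      have h2 : Function.Injective ψ := ℓ.injective.comp (κ.injective.comp ℓ.symm.injective)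
      exact one_ne_zero (h2 h1)
    refine ⟨f (ψ 1), ?_, ?_, fun g => f (ℓ (r (τ⁻¹ * s g))), fun γ => ?_⟩
    · rw [Ne, map_eq_zero]; exact hψ1
    · rw [← map_pow, ZMod.pow_card]
    · have h1 : τ⁻¹ * γ = κ (r γ) * (τ⁻¹ * s (π γ)) := by
        conv_lhs => rw [hr γ]
        simp only [κ, MulAut.conjNormal_apply]
        group
      have h2 : ℓ (κ (r γ)) = ψ (ℓ (r γ)) := by
        change _ = ℓ (κ (ℓ.symm (ℓ (r γ))))
        rw [Equiv.symm_apply_apply]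
      beta_reduce
      rw [h1, hc, h2, hψ, map_mul, add_comm]

/-- In the binomial expansion a positive power of y is multiplied by a power sum over F_p of
exponent below p - 1, which vanishes. -/
theorem sum_add_pow_of_lt {p : ℕ} [Fact p.Prime] {M : Type*} [Field M] (κ : ZMod p →+* M) (y : M)
    {j : ℕ} (hj : j < p) : ∑ x : ZMod p, (y + κ x) ^ j = κ (∑ x : ZMod p, x ^ j) := by
  simp only [add_pow]
  rw [Finset.sum_comm, Finset.sum_eq_single 0]
  · simp
  · intro k hk hk0
    have h1 : ∑ x : ZMod p, x ^ (j - k) = 0 := by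
      apply FiniteField.sum_pow_lt_card_sub_one
      rw [ZMod.card]
      have := Finset.mem_range.mp hk
      omega
    rw [← Finset.sum_mul, ← Finset.mul_sum]
    simp only [← map_pow]
    rw [← map_sum, h1]; simp
  · simp

section

variable {K Γ M : Type*} [Field K] [Group Γ] [Field M] [Algebra K M] (ρ : Γ →* (M ≃ₐ[K] M))
  [Fintype Γ]

/-- Sum over N first: it fixes l and moves y through all its F_p-translates, so y disappears from
the result. The remaining sum over cosets stays in the stable field L. -/
theorem conjSum_mul_pow_mem {p : ℕ} [Fact p.Prime] (L : IntermediateField K M)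
    (hstab : ∀ τ, ∀ l ∈ L, ρ τ l ∈ L) (N : Subgroup Γ) (hN : ∀ h ∈ N, ∀ l ∈ L, ρ h l = l)
    (κ : ZMod p →+* M) (hκ : ∀ x, κ x ∈ L) (ℓ : N ≃ ZMod p) (y : M)
    (hy : ∀ h : N, ρ (h : Γ)⁻¹ y = y + κ (ℓ h)) {l : M} (hl : l ∈ L) {j : ℕ} (hj : j < p) :
    conjSum ρ (l * y ^ j) ∈ L := by
  classical
  have := Fintype.ofFinite N
  have := Fintype.ofFinite (Γ ⧸ N)
  have h1 : ∑ h : N, ρ h (l * y ^ j) ∈ L := by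
    have h2 : ∑ h : N, ρ h (l * y ^ j) = l * κ (∑ x : ZMod p, x ^ j) := by
      rw [← sum_add_pow_of_lt κ y hj, Finset.mul_sum,
        ← Equiv.sum_comp ((Equiv.inv N).trans ℓ) (fun x => l * (y + κ x) ^ j)]
      refine Finset.sum_congr rfl fun h _ => ?_
      have := hy h⁻¹
      rw [Subgroup.coe_inv, inv_inv] at this
      rw [map_mul, map_pow, hN h h.2 l hl, this]; rfl
    rw [h2]; exact L.mul_mem hl (hκ _)
  have h3 : conjSum ρ (l * y ^ j) =
      ∑ q : Γ ⧸ N, ρ q.out (∑ h : N, ρ h (l * y ^ j)) := by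
    have hbij : Function.Bijective fun x : (Γ ⧸ N) × N => x.1.out * (x.2 : Γ) := by
      constructor
      · rintro ⟨q, h⟩ ⟨q', h'⟩ heq
        have e1 : ∀ (q : Γ ⧸ N) (h : N), ((q.out * (h : Γ) : Γ) : Γ ⧸ N) = q := fun q h => by
          rw [QuotientGroup.mk_mul_of_mem _ h.2, QuotientGroup.out_eq']
        have e2 : q = q' := by rw [← e1 q h, ← e1 q' h']; exact congrArg _ heq
        subst e2
        exact Prod.ext rfl (Subtype.ext (mul_left_cancel heq))
      · intro γ
        refine ⟨(γ, ⟨(γ : Γ ⧸ N).out⁻¹ * γ, ?_⟩), by simp⟩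
        rw [← QuotientGroup.eq, QuotientGroup.out_eq']
    rw [conjSum, ← hbij.sum_comp, Fintype.sum_prod_type]
    refine Finset.sum_congr rfl fun q _ => ?_
    rw [map_sum]
    refine Finset.sum_congr rfl fun h _ => ?_
    rw [← AlgEquiv.mul_apply, ← map_mul]
  rw [h3]
  exact L.sum_mem fun q _ => hstab _ _ h1

/-- An extension generated by integral elements and a root of an Artin–Schreier equation is
spanned by the small powers of the root. -/
theorem span_mul_pow_eq_top {p : ℕ} (hp : 1 < p) (E L : IntermediateField K M)
    (hint : ∀ l ∈ L, IsIntegral E l) (y : M) {α β : M} (hα : α ∈ L) (hα0 : α ≠ 0) (hβ : β ∈ L)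
    (hz : α * (y ^ p - y) + β ∈ E)
    (htop : IntermediateField.adjoin E ((L : Set M) ∪ {y}) = ⊤) :
    Submodule.span E {m : M | ∃ l ∈ L, ∃ j < p, m = l * y ^ j} = ⊤ := by
  set S := Submodule.span E {m : M | ∃ l ∈ L, ∃ j < p, m = l * y ^ j} with hS
  have hbasic : ∀ l ∈ L, ∀ j < p, l * y ^ j ∈ S := fun l hl j hj =>
    Submodule.subset_span ⟨l, hl, j, hj, rfl⟩
  set z' : E := ⟨_, hz⟩ with hz'
  have hyp : y ^ p = y + ((z' : M) - β) * α⁻¹ := by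
    rw [hz']; field_simp; ring
  have hyint : IsIntegral E y := by
    have h1 : Algebra.IsIntegral E (Algebra.adjoin E (L : Set M)) :=
      Algebra.IsIntegral.adjoin fun l hl => hint l hl
    have hw : ((z' : M) - β) * α⁻¹ ∈ Algebra.adjoin E (L : Set M) :=
      mul_mem (sub_mem ((Algebra.adjoin E (L : Set M)).algebraMap_mem z')
        (Algebra.subset_adjoin hβ)) (Algebra.subset_adjoin (L.inv_mem hα))
    have h2 : IsIntegral (Algebra.adjoin E (L : Set M)) y := by
      refine ⟨Polynomial.X ^ p - (Polynomial.X + Polynomial.C ⟨_, hw⟩), ?_, ?_⟩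
      · apply Polynomial.monic_X_pow_sub
        rw [Polynomial.degree_X_add_C]
        exact_mod_cast hp
      · rw [Polynomial.eval₂_sub, Polynomial.eval₂_add, Polynomial.eval₂_X_pow,
          Polynomial.eval₂_X, Polynomial.eval₂_C, hyp]
        exact sub_self _
    exact isIntegral_trans y h2
  have hmulL : ∀ l ∈ L, ∀ b ∈ S, l * b ∈ S := by
    intro l hl b hb
    have : S ≤ S.comap (LinearMap.mulLeft E l) := by
      rw [hS, Submodule.span_le]
      rintro _ ⟨l', hl', j, hj, rfl⟩
      change l * (l' * y ^ j) ∈ S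
      rw [← mul_assoc]
      exact hbasic _ (L.mul_mem hl hl') j hj
    exact this hb
  have hmuly : ∀ b ∈ S, y * b ∈ S := by
    intro b hb
    have : S ≤ S.comap (LinearMap.mulLeft E y) := by
      rw [hS, Submodule.span_le]
      rintro _ ⟨l, hl, j, hj, rfl⟩
      change y * (l * y ^ j) ∈ S
      have h1 : y * (l * y ^ j) = l * y ^ (j + 1) := by ring
      rw [h1]
      rcases Nat.lt_or_eq_of_le (Nat.succ_le_of_lt hj) with h | h
      · exact hbasic l hl _ h
      -- When the exponent reaches p, the relation y^p = y + (z' - β)/α brings it back to exponents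
      -- 1 and 0, with z' acting as a scalar of E.
      · have h2 : l * y ^ (j + 1) =
            l * y ^ 1 + (z' • ((l * α⁻¹) * y ^ 0) - (l * β * α⁻¹) * y ^ 0) := by
          rw [show j + 1 = p from h, hyp, Algebra.smul_def]
          change _ = l * y ^ 1 + ((z' : M) * _ - _)
          ring
        rw [h2]
        refine add_mem (hbasic l hl 1 hp) (sub_mem (S.smul_mem _ (hbasic _ ?_ 0 (by omega)))
          (hbasic _ ?_ 0 (by omega)))
        · exact L.mul_mem hl (L.inv_mem hα)
        · exact L.mul_mem (L.mul_mem hl hβ) (L.inv_mem hα)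
    exact this hb
  have halg : ∀ x ∈ (L : Set M) ∪ {y}, IsAlgebraic E x := by
    rintro x (hx | rfl)
    · exact (hint x hx).isAlgebraic
    · exact hyint.isAlgebraic
  have hadj : Algebra.adjoin E ((L : Set M) ∪ {y}) = ⊤ := by
    rw [← IntermediateField.adjoin_toSubalgebra_of_isAlgebraic halg, htop]; rfl
  rw [eq_top_iff]
  rintro m -
  have hm : m ∈ Algebra.adjoin E ((L : Set M) ∪ {y}) := hadj ▸ Algebra.mem_top
  have key : ∀ b ∈ S, m * b ∈ S := by
    induction hm using Algebra.adjoin_induction with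
    | mem x hx =>
      rcases hx with hx | rfl
      · exact hmulL x hx
      · exact hmuly
    | algebraMap r =>
      intro b hb
      rw [← Algebra.smul_def]
      exact S.smul_mem r hb
    | add u v _ _ hu hv =>
      intro b hb
      rw [add_mul]; exact add_mem (hu b hb) (hv b hb)
    | mul u v _ _ hu hv =>
      intro b hb
      rw [mul_assoc]; exact hu _ (hv b hb)
  have h1 : (1 : M) ∈ S := by simpa using hbasic 1 L.one_mem 0 (by omega)
  simpa using key 1 h1

/-- A finitely generated affine stable space is spanned by few invariants and `1`. -/
theorem exists_fixed_span (L : IntermediateField K M)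
    (hL : ∀ τ, (∀ l ∈ L, ρ τ l = l) → τ = 1) (hstab : ∀ τ, ∀ l ∈ L, ρ τ l ∈ L) (T : Finset M)
    (hT : ∀ τ, ∀ t ∈ T, ρ τ t ∈ Submodule.span L (insert 1 (T : Set M))) :
    ∃ w : Finset M, w.card ≤ T.card ∧ (∀ x ∈ w, x ∈ IntermediateField.fixedField ρ.range) ∧
      ∀ t ∈ T, t ∈ Submodule.span L (insert 1 (w : Set M)) := by
  classical
  set U := Submodule.span L (insert 1 (T : Set M)) with hUdef
  have h1U : (1 : M) ∈ U := Submodule.subset_span (Set.mem_insert _ _)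
  have hU : ∀ τ, ∀ u ∈ U, ρ τ u ∈ U := by
    intro τ u hu
    rw [hUdef] at hu
    induction hu using Submodule.span_induction with
    | mem x hx =>
      rcases hx with rfl | hx
      · rw [map_one]; exact h1U
      · exact hT τ x hx
    | zero => rw [map_zero]; exact U.zero_mem
    | add x y _ _ hx hy => rw [map_add]; exact U.add_mem hx hy
    | smul a x _ hx =>
      rw [Algebra.smul_def, map_mul]
      exact U.smul_mem ⟨ρ τ a, hstab τ a a.2⟩ hx
  have hspan := le_span_fixedField ρ L hL hstab U hU
  set V : Set M := {u | u ∈ U ∧ u ∈ IntermediateField.fixedField ρ.range} with hV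
  have h1V : ({1} : Set M) ⊆ V := by
    rintro _ rfl
    exact ⟨h1U, IntermediateField.one_mem _⟩
  -- The basis of invariants is made to contain 1, which is erased afterwards; this is what gives
  -- the bound |T| instead of |T| + 1.
  obtain ⟨b, hbV, h1b, hVb, hli⟩ := exists_linearIndepOn_id_extension
    (LinearIndepOn.singleton (R := L) (v := id) (i := (1 : M)) one_ne_zero) h1V
  have hb : (b : Set M) ⊆ Submodule.span L ((insert 1 T : Finset M) : Set M) := fun x hx => by
    rw [Finset.coe_insert]; exact (hbV hx).1
  have hrange : Set.range ((↑) : b → M) ≤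
      Submodule.span L ((insert 1 T : Finset M) : Set M) := by
    rw [Subtype.range_coe]; exact hb
  have hfin : Finite b := LinearIndependent.finite_of_le_span_finite (R := L) _ hli _ hrange
  have := Fintype.ofFinite b
  have hcard := linearIndependent_le_span' (R := L) _ hli _ hrange
  refine ⟨b.toFinset.erase 1, ?_, fun x hx => ?_, fun t ht => ?_⟩
  · have h1 : (1 : M) ∈ b.toFinset := Set.mem_toFinset.mpr (h1b rfl)
    rw [Finset.card_erase_of_mem h1]
    have h2 : b.toFinset.card ≤ (insert 1 T : Finset M).card := by
      rw [Set.toFinset_card]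
      simpa only [Finset.coe_sort_coe, Fintype.card_coe, Cardinal.mk_coe_finset, Nat.cast_le,
        Cardinal.mk_fintype] using hcard
    have h3 := Finset.card_insert_le (1 : M) T
    omega
  · exact (hbV (Set.mem_toFinset.mp (Finset.mem_of_mem_erase hx))).2
  · have h2 : t ∈ Submodule.span L V := hspan (Submodule.subset_span (Set.mem_insert_of_mem _ ht))
    have h3 : t ∈ Submodule.span L b := (Submodule.span_le.mpr hVb) h2
    refine Submodule.span_mono ?_ h3
    intro x hx
    by_cases hx1 : x = 1
    · left; exact hx1
    · right; simp [hx1, hx]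

/-- Descent over L(y) supplies at most |T| invariants; the extra one is the Artin–Schreier
invariant. Conjugate sums then show that nothing else is needed beyond the invariants of L. -/
theorem exists_generators_fixedField {p : ℕ} [Fact p.Prime] (hρ : Function.Injective ρ)
    (L : IntermediateField K M) (hstab : ∀ τ, ∀ l ∈ L, ρ τ l ∈ L)
    (hint : ∀ l ∈ L, IsIntegral (L ⊓ IntermediateField.fixedField ρ.range : IntermediateField K M) l)
    (N : Subgroup Γ) (hN : ∀ τ, τ ∈ N ↔ ∀ l ∈ L, ρ τ l = l)
    (κ : ZMod p →+* M) (hκ : ∀ x, κ x ∈ L) (ℓ : N ≃ ZMod p) (y : M)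
    (hy : ∀ h : N, ρ (h : Γ)⁻¹ y = y + κ (ℓ h))
    (hy' : ∀ τ, ρ τ y ∈ IntermediateField.adjoin K ((L : Set M) ∪ {y}))
    {α β : M} (hα : α ∈ L) (hα0 : α ≠ 0) (hβ : β ∈ L)
    (hz : α * (y ^ p - y) + β ∈ IntermediateField.fixedField ρ.range) (T : Finset M)
    (hT : ∀ τ, ∀ t ∈ T, ρ τ t ∈ Submodule.span (IntermediateField.adjoin K ((L : Set M) ∪ {y}))
      (insert 1 (T : Set M)))
    (htop : IntermediateField.adjoin K ((L : Set M) ∪ {y} ∪ T) = ⊤) :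
    ∃ S : Finset M, S.card ≤ T.card + 1 ∧ (∀ x ∈ S, x ∈ IntermediateField.fixedField ρ.range) ∧
      IntermediateField.fixedField ρ.range ≤ IntermediateField.adjoin K
        ({f | f ∈ L ∧ f ∈ IntermediateField.fixedField ρ.range} ∪ S) := by
  classical
  have hLL : (L : Set M) ⊆ IntermediateField.adjoin K ((L : Set M) ∪ {y}) :=
    Set.subset_union_left.trans (IntermediateField.subset_adjoin _ _)
  have hyL : y ∈ IntermediateField.adjoin K ((L : Set M) ∪ {y}) :=
    IntermediateField.subset_adjoin _ _ (Or.inr rfl)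
  obtain ⟨w, hwc, hw, hTw⟩ := exists_fixed_span ρ
    (IntermediateField.adjoin K ((L : Set M) ∪ {y})) (fun τ hτ => by
      have hτN : τ ∈ N := (hN τ).mpr fun l hl => hτ l (hLL hl)
      have h1 := hy ⟨τ, hτN⟩
      have h2 : ρ τ⁻¹ y = y := by
        conv_lhs => rw [← hτ y hyL]
        rw [← AlgEquiv.mul_apply, ← map_mul, inv_mul_cancel, map_one, AlgEquiv.one_apply]
      have h3 : κ (ℓ ⟨τ, hτN⟩) = 0 := by
        rw [h2] at h1; exact left_eq_add.mp h1
      -- Since `ℓ` is only a bijection here, its value at 1 is shown to be zero from the action of 1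
      -- on y.
      have h4 := hy 1
      rw [Subgroup.coe_one, inv_one, map_one, AlgEquiv.one_apply, left_eq_add] at h4
      have h5 := ℓ.injective (κ.injective (h3.trans h4.symm))
      exact congrArg Subtype.val h5)
    (fun τ l hl => by
      have : IntermediateField.adjoin K ((L : Set M) ∪ {y}) ≤
          (IntermediateField.adjoin K ((L : Set M) ∪ {y})).comap (ρ τ : M →ₐ[K] M) := by
        rw [IntermediateField.adjoin_le_iff]
        rintro x (hx | rfl)
        · exact hLL (hstab τ x hx)
        · exact hy' τ
      exact this hl) T hT
  refine ⟨insert (α * (y ^ p - y) + β) w, (Finset.card_insert_le _ _).trans (by omega), ?_, ?_⟩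
  · intro x hx
    rcases Finset.mem_insert.mp hx with rfl | hx
    · exact hz
    · exact hw x hx
  set E := IntermediateField.adjoin K ({f | f ∈ L ∧ f ∈ IntermediateField.fixedField ρ.range} ∪
    ((insert (α * (y ^ p - y) + β) w : Finset M) : Set M)) with hE
  have hLE : ∀ f ∈ L, f ∈ IntermediateField.fixedField ρ.range → f ∈ E := fun f h1 h2 =>
    IntermediateField.subset_adjoin _ _ (Or.inl ⟨h1, h2⟩)
  have hwE : ∀ x ∈ insert (α * (y ^ p - y) + β) w, x ∈ E := fun x hx =>
    IntermediateField.subset_adjoin _ _ (Or.inr hx)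
  refine fixedField_le_of_span ρ hρ ?_ _ ?_ (span_mul_pow_eq_top (Fact.out : p.Prime).one_lt E L ?_
    y hα hα0 hβ (hwE _ (Finset.mem_insert_self _ _)) ?_)
  · rw [hE, IntermediateField.adjoin_le_iff]
    rintro x (hx | hx)
    · exact hx.2
    · rcases Finset.mem_insert.mp hx with rfl | hx
      · exact hz
      · exact hw x hx
  · rintro _ ⟨l, hl, j, hj, rfl⟩
    exact hLE _ (conjSum_mul_pow_mem ρ L hstab N (fun h hh => (hN h).mp hh) κ hκ ℓ y hy hl hj)
      (conjSum_mem ρ _)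
  · intro l hl
    have hle : L ⊓ IntermediateField.fixedField ρ.range ≤ E := fun f hf => hLE f hf.1 hf.2
    exact (hint l hl).map_of_comp_eq (IntermediateField.inclusion hle).toRingHom (RingHom.id M) rfl
  · set F := IntermediateField.adjoin E ((L : Set M) ∪ {y}) with hF
    have h1 : IntermediateField.adjoin K ((L : Set M) ∪ {y}) ≤ F.restrictScalars K := by
      rw [IntermediateField.adjoin_le_iff]
      exact IntermediateField.subset_adjoin E ((L : Set M) ∪ {y})
    have h2 : ∀ t ∈ T, t ∈ F := by
      intro t ht
      have ht' := hTw t ht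
      clear ht
      induction ht' using Submodule.span_induction with
      | mem x hx =>
        rcases hx with rfl | hx
        · exact F.one_mem
        · exact F.algebraMap_mem ⟨x, hwE x (Finset.mem_insert_of_mem hx)⟩
      | zero => exact F.zero_mem
      | add x y _ _ hx hy => exact F.add_mem hx hy
      | smul a x _ hx => exact F.mul_mem (h1 a.2) hx
    have h3 : (⊤ : IntermediateField K M) ≤ F.restrictScalars K := by
      rw [← htop, IntermediateField.adjoin_le_iff]
      rintro x (hx | hx)
      · exact IntermediateField.subset_adjoin E ((L : Set M) ∪ {y}) hx
      · exact h2 x hx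
    rw [eq_top_iff]
    intro x _
    exact h3 (IntermediateField.mem_top (x := x))

end

/-! ### Kernels of order p -/

/-- The final count: dropping the section and one further variable leaves exactly enough room for
the Artin–Schreier invariant. -/
theorem card_compl_section {Γ G : Type*} [Fintype Γ] [Fintype G] [DecidableEq Γ] (s : G → Γ)
    (hs : Function.Injective s) (γ₁ : Γ) (hγ₁ : γ₁ ∉ Set.range s) :
    Nat.card G + ((insert γ₁ (Finset.univ.image s))ᶜ.card + 1) = Nat.card Γ := by
  have h1 : γ₁ ∉ Finset.univ.image s := by simpa using hγ₁
  have h2 := Finset.card_add_card_compl (insert γ₁ (Finset.univ.image s))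
  rw [Finset.card_insert_of_notMem h1, Finset.card_image_of_injective _ hs, Finset.card_univ] at h2
  rw [Nat.card_eq_fintype_card, Nat.card_eq_fintype_card]
  omega

section

variable {K Γ G : Type*} [Field K] [Group Γ] [Group G] [Fintype Γ]

theorem isSparselyGenerated_of_generators (π : Γ →* G) (hπ : Function.Surjective π)
    (S : Finset (RatFunField K Γ)) (hcard : Nat.card G + S.card ≤ Nat.card Γ)
    (h : noetherField K Γ ≤ IntermediateField.adjoin K
      ({f | f ∈ (inflation K π hπ).fieldRange ∧ f ∈ noetherField K Γ} ∪ S))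
    (hS : ∀ x ∈ S, x ∈ noetherField K Γ) : IsSparselyGenerated K Γ G := by
  classical
  refine ⟨noetherInflation K π hπ, S.subtype (· ∈ noetherField K Γ), ?_, ?_⟩
  · have himage : (noetherField K Γ).val '' (Set.range (noetherInflation K π hπ) ∪
        (S.subtype (· ∈ noetherField K Γ) : Finset (noetherField K Γ))) =
        {f | f ∈ (inflation K π hπ).fieldRange ∧ f ∈ noetherField K Γ} ∪ S := by
      rw [Set.image_union]
      congr 1
      · ext f
        constructor
        · rintro ⟨_, ⟨g, rfl⟩, rfl⟩
          exact ⟨⟨g, rfl⟩, (noetherInflation K π hπ g).2⟩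
        · rintro ⟨⟨g, rfl⟩, hg⟩
          exact ⟨_, ⟨⟨g, (inflation_mem_noetherField_iff K π hπ g).mp hg⟩, rfl⟩, rfl⟩
      · ext f
        constructor
        · rintro ⟨x, hx, rfl⟩
          exact Finset.mem_subtype.mp hx
        · intro hf
          exact ⟨⟨f, hS f hf⟩, Finset.mem_subtype.mpr hf, rfl⟩
    rw [← himage, ← IntermediateField.adjoin_map] at h
    rw [eq_top_iff]
    intro f _
    obtain ⟨g, hg, hgf⟩ := h f.2
    have : g = f := Subtype.ext hgf
    rwa [← this]
  · have : (S.subtype (· ∈ noetherField K Γ)).card ≤ S.card := by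
      rw [Finset.card_subtype]; exact Finset.card_filter_le _ _
    omega

theorem isIntegral_of_mem_fieldRange (π : Γ →* G) (hπ : Function.Surjective π)
    {l : RatFunField K Γ} (hl : l ∈ (inflation K π hπ).fieldRange) :
    IsIntegral ((inflation K π hπ).fieldRange ⊓
      IntermediateField.fixedField (regularAction K Γ).range :
        IntermediateField K (RatFunField K Γ)) l := by
  have : Finite G := Finite.of_surjective π hπ
  obtain ⟨f, rfl⟩ := hl
  let ψ : noetherField K G →+*
      ((inflation K π hπ).fieldRange ⊓ IntermediateField.fixedField (regularAction K Γ).range :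
        IntermediateField K (RatFunField K Γ)) :=
    ((inflation K π hπ : RatFunField K G →+* RatFunField K Γ).comp
      (algebraMap (noetherField K G) (RatFunField K G))).codRestrict _ (fun g =>
        ⟨⟨g, rfl⟩, (inflation_mem_noetherField_iff K π hπ g).mpr g.2⟩)
  exact (isIntegral_fixedField (regularAction K G) f).map_of_comp_eq ψ
    (inflation K π hπ : RatFunField K G →+* RatFunField K Γ) rfl

theorem linForm_comp_mem (π : Γ →* G) (hπ : Function.Surjective π) (d : G → K) :
    linForm K (fun γ => d (π γ)) ∈ (inflation K π hπ).fieldRange := by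
  have : Finite G := Finite.of_surjective π hπ
  have := Fintype.ofFinite G
  exact ⟨linForm K d, inflation_linForm K π hπ d⟩

theorem mem_ker_iff_forall_fieldRange (π : Γ →* G) (hπ : Function.Surjective π) (τ : Γ) :
    τ ∈ π.ker ↔ ∀ l ∈ (inflation K π hπ).fieldRange, regularAction K Γ τ l = l := by
  constructor
  · rintro hτ _ ⟨f, rfl⟩
    change regularAction K Γ τ (inflation K π hπ f) = inflation K π hπ f
    rw [inflation_regularAction, MonoidHom.mem_ker.mp hτ, map_one, AlgEquiv.one_apply]
  · intro h
    have h1 := h _ ⟨var K 1, rfl⟩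
    change regularAction K Γ τ (inflation K π hπ (var K 1)) = inflation K π hπ (var K 1) at h1
    rw [inflation_regularAction, regularAction_var, mul_one] at h1
    exact var_injective K G ((inflation K π hπ).injective h1)

/-- All variables lie in the affine space spanned by those outside a section and one more point. -/
theorem var_mem_span (π : Γ →* G) (hπ : Function.Surjective π)
    (L : IntermediateField K (RatFunField K Γ)) (hL : (inflation K π hπ).fieldRange ≤ L)
    (s : G → Γ) (hs : ∀ g, π (s g) = g) (c : Γ → K) (hc : ∀ g, c (s g) = 0)
    (hcL : linForm K c ∈ L) (γ₁ : Γ) (hγ₁ : c γ₁ ≠ 0) (T : Set (RatFunField K Γ))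
    (hT : ∀ γ, γ ∉ Set.range s → γ ≠ γ₁ → var K γ ∈ T) (γ : Γ) :
    var K γ ∈ Submodule.span L (insert 1 T) := by
  classical
  set U := Submodule.span L (insert 1 T)
  have hLU : ∀ l ∈ L, l ∈ U := fun l hl => by
    have := U.smul_mem (⟨l, hl⟩ : L) (Submodule.subset_span (Set.mem_insert 1 T))
    rwa [Algebra.smul_def, mul_one] at this
  have hKU : ∀ (a : K) (u : RatFunField K Γ), u ∈ U → a • u ∈ U := fun a u hu => by
    have := U.smul_mem (algebraMap K L a) hu
    rwa [algebraMap_smul] at this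
  have h1 : ∀ δ, δ ∉ Set.range s → var K δ ∈ U := by
    have h0 : ∀ δ, δ ∉ Set.range s → δ ≠ γ₁ → var K δ ∈ U := fun δ h h' =>
      Submodule.subset_span (Set.mem_insert_of_mem _ (hT δ h h'))
    intro δ hδ
    by_cases hδ1 : δ = γ₁
    · subst hδ1
      have h2 := linForm_apply K c
      rw [← Finset.add_sum_erase _ _ (Finset.mem_univ δ)] at h2
      -- The linear form with coefficients `c` does not involve the section, so it can be solved for
      -- the variable at γ₁.
      have h3 : var K δ = (c δ)⁻¹ •
          (linForm K c - ∑ x ∈ Finset.univ.erase δ, c x • var K x) := by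
        rw [h2, add_sub_cancel_right, smul_smul, inv_mul_cancel₀ hγ₁, one_smul]
      rw [h3]
      refine hKU _ _ (U.sub_mem (hLU _ hcL) (U.sum_mem fun x hx => ?_))
      by_cases hxs : x ∈ Set.range s
      · obtain ⟨g, rfl⟩ := hxs
        rw [hc, zero_smul]; exact U.zero_mem
      · exact hKU _ _ (h0 x hxs (Finset.ne_of_mem_erase hx))
    · exact h0 δ hδ hδ1
  by_cases hγ : γ ∈ Set.range s
  · obtain ⟨g, rfl⟩ := hγ
    -- The fibre sum over g lies in L and involves just one section variable, which can be isolated.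
    have h2 := inflation_var K π hπ g
    rw [← Finset.add_sum_erase _ _ (Finset.mem_univ (s g)), if_pos (hs g)] at h2
    rw [← sub_eq_iff_eq_add] at h2
    rw [← h2]
    refine U.sub_mem (hLU _ (hL ⟨_, rfl⟩)) (U.sum_mem fun x hx => ?_)
    split_ifs with hx2
    · apply h1
      rintro ⟨g', rfl⟩
      rw [hs] at hx2
      exact Finset.ne_of_mem_erase hx (by rw [hx2])
    · exact U.zero_mem
  · exact h1 γ hγ

/-- The conjugates of the Artin–Schreier element sum up to an affine function of it. -/
theorem exists_invariant_affine (π : Γ →* G) (hπ : Function.Surjective π) (s : G → Γ)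
    (hs : ∀ g, π (s g) = g) (z : RatFunField K Γ)
    (hz : ∀ h ∈ π.ker, regularAction K Γ h z = z) (a : Γ → K) (ha : ∀ τ, a τ ≠ 0)
    (e : Γ → RatFunField K Γ) (he : ∀ τ, e τ ∈ (inflation K π hπ).fieldRange)
    (hze : ∀ τ, regularAction K Γ τ z = a τ • z + e τ) :
    ∃ α ∈ (inflation K π hπ).fieldRange, α ≠ 0 ∧ ∃ β ∈ (inflation K π hπ).fieldRange,
      α * z + β ∈ noetherField K Γ := by
  classical
  have : Finite G := Finite.of_surjective π hπ
  have := Fintype.ofFinite G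
  -- These are the coefficients of z and 1 in the conjugate sum of x(1) * z. As z is fixed by the
  -- kernel, γ can be replaced by `s (π γ)`; the coefficients then depend only on `π γ`, which puts
  -- α and β in L.
  refine ⟨linForm K (fun γ => a (s (π γ))), linForm_comp_mem π hπ (fun g => a (s g)),
    linForm_ne_zero K (fun h => ha _ (congrFun h 1)), ∑ γ, e (s (π γ)) * var K γ, ?_, ?_⟩
  · have : ∑ γ, e (s (π γ)) * var K γ = ∑ g, e (s g) * inflation K π hπ (var K g) := by
      simp only [inflation_var, Finset.mul_sum, mul_ite, mul_zero]
      rw [Finset.sum_comm]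
      refine Finset.sum_congr rfl fun γ _ => ?_
      rw [Finset.sum_ite_eq]; simp
    rw [this]
    exact IntermediateField.sum_mem _ fun g _ => IntermediateField.mul_mem _ (he _) ⟨_, rfl⟩
  · have : linForm K (fun γ => a (s (π γ))) * z + ∑ γ, e (s (π γ)) * var K γ =
        conjSum (regularAction K Γ) (var K 1 * z) := by
      rw [conjSum, linForm_apply, Finset.sum_mul, ← Finset.sum_add_distrib]
      refine Finset.sum_congr rfl fun γ _ => ?_
      have h1 : regularAction K Γ γ z = regularAction K Γ (s (π γ)) z := by
        have h2 : γ = s (π γ) * ((s (π γ))⁻¹ * γ) := by group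
        have h3 : (s (π γ))⁻¹ * γ ∈ π.ker := by
          rw [MonoidHom.mem_ker, map_mul, map_inv, hs, inv_mul_cancel]
        conv_lhs => rw [h2]
        rw [regularAction_mul_apply, hz _ h3]
      rw [map_mul, regularAction_var, mul_one, h1, hze, Algebra.smul_def, Algebra.smul_def]
      ring
    rw [this]
    exact conjSum_mem _ _

end

theorem isSparselyGenerated_of_card_ker {K Γ G : Type*} [Field K] [Group Γ] [Group G]
    [Finite Γ] {p : ℕ} [Fact p.Prime] [CharP K p] (π : Γ →* G) (hπ : Function.Surjective π)
    (hker : Nat.card π.ker = p) : IsSparselyGenerated K Γ G := by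
  classical
  have := Fintype.ofFinite Γ
  have : Finite G := Finite.of_surjective π hπ
  have := Fintype.ofFinite G
  obtain ⟨s, c, ℓ, hs, hcs, hcker, hcτ⟩ := exists_coeff K π hπ hker
  choose a ha0 hap d hd using hcτ
  set ρ := regularAction K Γ with hρ
  set L := (inflation K π hπ).fieldRange with hLdef
  have hstab : ∀ τ, ∀ l ∈ L, ρ τ l ∈ L := by
    rintro τ _ ⟨f, rfl⟩
    exact ⟨_, (inflation_regularAction K π hπ τ f).symm⟩
  set X : RatFunField K Γ := linForm K (fun _ => 1) with hX
  have hXL : X ∈ L := linForm_comp_mem π hπ (fun _ => 1)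
  have hX0 : X ≠ 0 := linForm_ne_zero K (fun h => one_ne_zero (congrFun h 1))
  have hρX : ∀ τ, ρ τ X = X := fun τ => regularAction_linForm K τ _
  -- The kernel changes the linear form by F_p-multiples of the invariant X; dividing by X turns
  -- these into constant translations.
  set y : RatFunField K Γ := linForm K c / X with hy
  let κ : ZMod p →+* RatFunField K Γ := (algebraMap K _).comp (ZMod.castHom (dvd_refl p) K)
  have hyker : ∀ h : π.ker, ρ (h : Γ)⁻¹ y = y + κ (ℓ h) := fun h => by
    have h1 : ρ (h : Γ)⁻¹ (linForm K c) = linForm K c + κ (ℓ h) * X := by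
      rw [hρ, regularAction_linForm]
      have : (fun γ => c ((h : Γ)⁻¹⁻¹ * γ)) =
          c + (ZMod.castHom (dvd_refl p) K (ℓ h)) • (fun _ => (1 : K)) := by
        funext γ
        rw [inv_inv, hcker]; simp
      rw [this, map_add, map_smul, Algebra.smul_def]; rfl
    rw [hy, map_div₀, hρX, h1]
    field_simp
  have hyτ : ∀ τ, ρ τ y = a τ • y + linForm K (fun γ => d τ (π γ)) / X := fun τ => by
    have h1 : ρ τ (linForm K c) = a τ • linForm K c + linForm K (fun γ => d τ (π γ)) := by
      rw [hρ, regularAction_linForm, ← map_smul, ← map_add]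
      congr 1
      funext γ
      exact hd τ γ
    rw [hy, map_div₀, hρX, h1, add_div, smul_div_assoc]
  have heL : ∀ τ, linForm K (fun γ => d τ (π γ)) / X ∈ L := fun τ =>
    L.div_mem (linForm_comp_mem π hπ (d τ)) hXL
  have : CharP (RatFunField K Γ) p := charP_of_injective_algebraMap (algebraMap K _).injective p
  obtain ⟨α, hα, hα0, β, hβ, hz⟩ := exists_invariant_affine π hπ s hs (y ^ p - y)
    (fun h hh => by
      have h1 := hyker (⟨h, hh⟩⁻¹)
      rw [Subgroup.coe_inv, inv_inv] at h1
      change ρ h (y ^ p - y) = _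
      rw [map_sub, map_pow, h1, add_pow_char, ← map_pow, ZMod.pow_card]
      ring) a ha0
    (fun τ => (linForm K (fun γ => d τ (π γ)) / X) ^ p - linForm K (fun γ => d τ (π γ)) / X)
    (fun τ => L.sub_mem (L.pow_mem (heL τ) p) (heL τ))
    (fun τ => by
      change ρ τ (y ^ p - y) = _
      rw [map_sub, map_pow, hyτ, add_pow_char, smul_pow, hap, smul_sub]
      ring)
  -- A point of the fibre over 1 where `c` equals 1, so its variable can be eliminated.
  obtain ⟨h₁, hh₁⟩ := ℓ.surjective 1
  have hγ₁ : c (h₁ * s 1) ≠ 0 := by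
    rw [hcker, hcs, hh₁, map_one, zero_add]; exact one_ne_zero
  set γ₁ : Γ := h₁ * s 1
  have hγ₁s : γ₁ ∉ Set.range s := by
    rintro ⟨g, hg⟩
    exact hγ₁ (by rw [← hg, hcs])
  set T : Finset (RatFunField K Γ) := ((insert γ₁ (Finset.univ.image s))ᶜ).image (var K) with hT
  set L₁ := IntermediateField.adjoin K ((L : Set (RatFunField K Γ)) ∪ {y}) with hL₁
  have hLL₁ : L ≤ L₁ := fun l hl => IntermediateField.subset_adjoin _ _ (Or.inl hl)
  have hyL₁ : y ∈ L₁ := IntermediateField.subset_adjoin _ _ (Or.inr rfl)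
  have hvar : ∀ γ, var K γ ∈ Submodule.span L₁ (insert 1 (T : Set (RatFunField K Γ))) := by
    refine var_mem_span π hπ L₁ hLL₁ s hs c hcs ?_ γ₁ hγ₁ T (fun γ h h' => ?_)
    · have : linForm K c = y * X := by rw [hy]; field_simp
      rw [this]; exact L₁.mul_mem hyL₁ (hLL₁ hXL)
    · rw [hT, Finset.coe_image]
      refine ⟨γ, ?_, rfl⟩
      simpa [h'] using h
  obtain ⟨S, hS, hSfix, hgen⟩ := exists_generators_fixedField ρ (regularAction_injective K Γ) L hstab
    (fun l hl => isIntegral_of_mem_fieldRange π hπ hl) π.ker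
    (mem_ker_iff_forall_fieldRange π hπ) κ (fun x => L.algebraMap_mem _) ℓ y hyker
    (fun τ => by
      rw [hyτ]
      exact L₁.add_mem (L₁.smul_mem hyL₁) (hLL₁ (heL τ))) hα hα0 hβ hz T
    (fun τ t ht => by
      obtain ⟨γ, -, rfl⟩ := Finset.mem_image.mp ht
      rw [hρ, regularAction_var]
      exact hvar _)
    (by
      apply eq_top_of_var_mem
      intro γ
      set F := IntermediateField.adjoin K ((L : Set (RatFunField K Γ)) ∪ {y} ∪ T) with hF
      have hL₁F : L₁ ≤ F := IntermediateField.adjoin.mono _ _ _ Set.subset_union_left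
      have h := hvar γ
      generalize var K γ = v at h ⊢
      induction h using Submodule.span_induction with
      | mem x hx =>
        rcases hx with rfl | hx
        · exact F.one_mem
        · exact IntermediateField.subset_adjoin _ _ (Or.inr hx)
      | zero => exact F.zero_mem
      | add x y _ _ hx hy => exact F.add_mem hx hy
      | smul a x _ hx => exact F.mul_mem (hL₁F a.2) hx)
  refine isSparselyGenerated_of_generators π hπ S ?_ hgen hSfix
  have h1 := card_compl_section s (Function.LeftInverse.injective hs) γ₁ hγ₁s
  have h2 : T.card ≤ _ := Finset.card_image_le
  omega

/-! ### Induction on the order of the kernel -/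

/-- Subgroups of a normal cyclic subgroup are normal. -/
theorem normal_zpowers_of_mem_cyclic {Γ : Type*} [Group Γ] (N : Subgroup Γ) [N.Normal]
    [IsCyclic N] {x : Γ} (hx : x ∈ N) : (Subgroup.zpowers x).Normal := by
  obtain ⟨a, ha⟩ := IsCyclic.exists_generator (α := N)
  refine ⟨fun y hy g => ?_⟩
  obtain ⟨m, hm⟩ := Subgroup.mem_zpowers_iff.mp (ha ⟨x, hx⟩)
  obtain ⟨k, hk⟩ := Subgroup.mem_zpowers_iff.mp
    (ha ⟨g * a * g⁻¹, Subgroup.Normal.conj_mem ‹_› _ a.2 g⟩)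
  obtain ⟨j, rfl⟩ := Subgroup.mem_zpowers_iff.mp hy
  have hm' : (a : Γ) ^ m = x := congrArg Subtype.val hm
  have hk' : (a : Γ) ^ k = g * a * g⁻¹ := congrArg Subtype.val hk
  -- Conjugation by g is the k-th power map on the generator, hence on the whole cyclic group.
  have : g * x ^ j * g⁻¹ = x ^ (k * j) := by
    rw [← hm', ← conj_zpow, ← conj_zpow, ← hk', ← zpow_mul, ← zpow_mul, ← zpow_mul]
    congr 1; ring
  rw [this]
  exact Subgroup.mem_zpowers_iff.mpr ⟨_, rfl⟩

theorem normal_zpowers_of_mem_center {Γ : Type*} [Group Γ] {x : Γ} (hx : x ∈ Subgroup.center Γ) :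
    (Subgroup.zpowers x).Normal := by
  refine ⟨fun y hy g => ?_⟩
  have : y ∈ Subgroup.center Γ := (Subgroup.zpowers_le.mpr hx) hy
  rw [Subgroup.mem_center_iff.mp this g, mul_inv_cancel_right]
  exact hy

theorem isSparselyGenerated_of_isPGroup_ker {K Γ G : Type*} [Field K] [Group Γ] [Group G]
    [Finite Γ] {p : ℕ} [Fact p.Prime] [CharP K p] (π : Γ →* G) (hπ : Function.Surjective π)
    (hp : IsPGroup p π.ker) (hcase : IsCyclic π.ker ∨ π.ker ≤ Subgroup.center Γ) :
    IsSparselyGenerated K Γ G := by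
  induction hn : Nat.card π.ker using Nat.strong_induction_on generalizing Γ with
  | _ n ih =>
  by_cases h1 : π.ker = ⊥
  · exact isSparselyGenerated_of_bijective π ⟨(MonoidHom.ker_eq_bot_iff π).mp h1, hπ⟩
  have : Nontrivial π.ker := (Subgroup.nontrivial_iff_ne_bot _).mpr h1
  obtain ⟨x, hx⟩ : ∃ x : π.ker, orderOf x = p := by
    apply exists_prime_orderOf_dvd_card'
    exact hp.card_eq_or_dvd.resolve_left Finite.one_lt_card.ne'
  have hx' : orderOf (x : Γ) = p := by rw [Subgroup.orderOf_coe, hx]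
  have hCn : (Subgroup.zpowers (x : Γ)).Normal := by
    rcases hcase with h | h
    · exact normal_zpowers_of_mem_cyclic π.ker x.2
    · exact normal_zpowers_of_mem_center (h x.2)
  set C := Subgroup.zpowers (x : Γ) with hC
  have hle : C ≤ π.ker := Subgroup.zpowers_le.mpr x.2
  have hcard : Nat.card C = p := by rw [hC, Nat.card_zpowers, hx']
  let q : Γ →* Γ ⧸ C := QuotientGroup.mk' C
  have hq : Function.Surjective q := QuotientGroup.mk'_surjective C
  let π' : Γ ⧸ C →* G := QuotientGroup.lift C π hle
  have hπ' : Function.Surjective π' := fun g => by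
    obtain ⟨γ, rfl⟩ := hπ g
    exact ⟨q γ, rfl⟩
  have hk : π'.ker = π.ker.map q := QuotientGroup.ker_lift C π hle
  have hsurj : Function.Surjective (q.subgroupMap π.ker) := q.subgroupMap_surjective π.ker
  have hlt : Nat.card π'.ker < n := by
    rw [hk, ← hn]
    refine lt_of_le_of_ne (Nat.card_le_card_of_surjective _ hsurj) fun heq => ?_
    have hbij := hsurj.bijective_of_nat_card_le heq.ge
    -- If the kernel did not shrink, the quotient map would be injective on it, yet it kills x,
    -- which has order p.
    have hx1 : x = 1 := hbij.1 (Subtype.ext (by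
      change q x = q 1
      rw [map_one]
      exact (QuotientGroup.eq_one_iff _).mpr (Subgroup.mem_zpowers _)))
    rw [hx1, orderOf_one] at hx
    exact (Fact.out : p.Prime).one_lt.ne hx
  refine IsSparselyGenerated.trans (Δ := Γ ⧸ C)
    (isSparselyGenerated_of_card_ker (p := p) q hq (by rw [QuotientGroup.ker_mk', hcard])) ?_
  refine ih _ hlt π' hπ' ?_ ?_ rfl
  · rw [hk]; exact hp.map q
  · rw [hk]
    rcases hcase with h | h
    · left; exact isCyclic_of_surjective _ hsurj
    · right
      rintro _ ⟨y, hy, rfl⟩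
      rw [Subgroup.mem_center_iff]
      intro g
      obtain ⟨γ, rfl⟩ := hq g
      rw [← map_mul, ← map_mul, Subgroup.mem_center_iff.mp (h hy) γ]

end Noether

end

theorem theorem1p8 {K H Gt G : Type*} [Field K] [Group H] [Group Gt] [Group G]
    [Finite H] [Finite G] (p : ℕ) (hp : 0 < p) [CharP K p]
    (S : GroupExtension H Gt G) (hH : IsPGroup p H)
    (hcase : IsCyclic H ∨ S.inl.range ≤ Subgroup.center Gt) :
    ∃ φ : Noether.noetherField K G →ₐ[K] Noether.noetherField K Gt,
      Noether.IsRational φ.fieldRange (Noether.noetherField K Gt) := by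
  have hpp : Fact p.Prime := ⟨(CharP.char_is_prime_or_zero K p).resolve_right hp.ne'⟩
  have hr := S.range_inl_eq_ker_rightHom
  have e : H ≃* S.rightHom.ker :=
    (MonoidHom.ofInjective S.inl_injective).trans (MulEquiv.subgroupCongr hr)
  have : Finite S.rightHom.ker := Finite.of_equiv H e.toEquiv
  have : Finite Gt := by
    have : Finite (Gt ⧸ S.rightHom.ker) :=
      Finite.of_injective _ (QuotientGroup.kerLift_injective S.rightHom)
    refine Nat.finite_of_card_ne_zero ?_
    rw [Subgroup.card_eq_card_quotient_mul_card_subgroup S.rightHom.ker]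
    exact mul_ne_zero Nat.card_pos.ne' Nat.card_pos.ne'
  refine Noether.IsSparselyGenerated.isRational
    (Noether.isSparselyGenerated_of_isPGroup_ker (p := p) S.rightHom S.rightHom_surjective
      (hH.of_equiv e) ?_)
  rcases hcase with h | h
  · left; exact isCyclic_of_surjective e e.surjective
  · right; rwa [← hr]
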